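/- Let $n\ge 2$ and let $H\in C^3(\mathbb R^n,\mathbb R)$ satisfy $H\ge 0$. Assume that $H$ is a Morse function (there is $C\ge 1$ with $|\xi|/C\le|\nabla^2H(x)\xi|\le C|\xi|$ for all $\xi\in\mathbb R^n$ and all critical points $x$ of $H$), that $\liminf_{|x|\to\infty}|\nabla H(x)|>0$ and $\liminf_{|x|\to\infty}\bigl(|\nabla H(x)|^2-\Delta H(x)\bigr)>-\infty$, and that $H$ has a unique global minimum, with value $0$. For $\tau>0$ let $\nu^\tau$ be the probability measure on $\mathbb R^n$ with density proportional to $e^{-H/\tau}$. For $\tau_1,\tau_2>0$ put $\pi^+=\nu^{\tau_1}\otimes\nu^{\tau_2}$, $\pi^-=\nu^{\tau_2}\otimes\nu^{\tau_1}$, $\mu=\frac12(\pi^++\pi^-)$ on $\mathbb R^n\times\mathbb R^n$ and $$\mathcal E_\mu(f)=\frac12\int\bigl(\tau_1|\nabla_{x_1}f|^2+\tau_2|\nabla_{x_2}f|^2\bigr)\,d\pi^++\frac12\int\bigl(\tau_2|\nabla_{x_1}f|^2+\tau_1|\nabla_{x_2}f|^2\bigr)\,d\pi^-.$$ Let $H^1(\mu)$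 be the set of $f\in L^2(\mu)$ whose weak gradient exists and lies in $L^2(\mu)$, and let $$S(\tau_1,\tau_2)=\sup\Bigl\{\frac{\operatorname{Var}_\mu(f)}{\mathcal E_\mu(f)} : f\in H^1(\mu),\ \mathcal E_\mu(f)>0\Bigr\}\in[0,\infty].$$ Then there are $\tau_0,\kappa_0>0$, depending only on $n$ and $H$, such that the following holds. - If $n\ge 3$, then for every $\eta>0$ there is $C_\eta>0$, depending only on $\eta$, $n$ and $H$, such that $$S(\tau_1,\tau_2)\ \ge\ C_\eta\,(\tau_2/\tau_1)^{(1-\eta)(n-2)/2}\qquad\text{for all }\tau_1,\tau_2>0\text{ with }\tau_2\le\tau_0,\ \tau_1/\tau_2\le\kappa_0.$$ - If $n=2$, then there is $c>0$, depending only on $H$, such that $$S(\tau_1,\tau_2)\ \ge\ c\,\ln(\tau_2/\tau_1)\qquad\text{for all }\tau_1,\tau_2>0\text{ with }\tau_2\le\tau_0,\ \tau_1/\tau_2\le\kappa_0.$$ -/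

import Mathlib

open MeasureTheory ProbabilityTheory Filter
open scoped ENNReal ContDiff

namespace InfSwap

/-- The single-particle state space `ℝⁿ` with its Euclidean structure. -/
abbrev Space (n : ℕ) : Type := EuclideanSpace ℝ (Fin n)

/-- The Hessian `∇²H(x)` as a linear operator on `ℝⁿ`. -/
noncomputable def hessian {n : ℕ} (H : Space n → ℝ) (x : Space n) : Space n →L[ℝ] Space n :=
  fderiv ℝ (gradient H) x

/-- The Hessian is uniformly non-degenerate on the set of critical points. -/
def IsMorse {n : ℕ} (H : Space n → ℝ) : Prop :=
  ∃ C : ℝ, 1 ≤ C ∧ ∀ x : Space n, gradient H x = 0 →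
    ∀ ξ : Space n, ‖ξ‖ / C ≤ ‖hessian H x ξ‖ ∧ ‖hessian H x ξ‖ ≤ C * ‖ξ‖

/-- Smoothness, nonnegativity, Morse property and growth at infinity of the potential.
The lower limits as `|x| → ∞` are taken in the extended reals, since they may be infinite. -/
structure GrowthAssumption {n : ℕ} (H : Space n → ℝ) : Prop where
  contDiff : ContDiff ℝ 3 H
  nonneg : ∀ x, 0 ≤ H x
  morse : IsMorse H
  gradient_growth : ∃ C : ℝ, 0 < C ∧
    (C : EReal) ≤ liminf (fun x : Space n => ((‖gradient H x‖ : ℝ) : EReal))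
      (Bornology.cobounded (Space n))
  lyapunov : ∃ K : ℝ, 0 ≤ K ∧
    ((-K : ℝ) : EReal) ≤
      liminf (fun x : Space n => ((‖gradient H x‖ ^ 2 - Laplacian.laplacian H x : ℝ) : EReal))
        (Bornology.cobounded (Space n))

/-- `H` has a unique global minimum, normalized to the value `0`. -/
def HasUniqueGlobalMin {n : ℕ} (H : Space n → ℝ) : Prop :=
  ∃ m : Space n, H m = 0 ∧ ∀ x, x ≠ m → 0 < H x

/-- The Gibbs measure `ν^τ(dx) = exp(-H(x)/τ) dx / Z^τ`. -/
noncomputable def gibbs {n : ℕ} (H : Space n → ℝ) (τ : ℝ) : Measure (Space n) :=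
  (volume : Measure (Space n)).tilted (fun x => -H x / τ)

/-- The product measure `ν^{τ} ⊗ ν^{τ'}`. This is `π⁺` for `(τ, τ') = (τ₁, τ₂)` and `π⁻` for
`(τ, τ') = (τ₂, τ₁)`. -/
noncomputable def gibbsProd {n : ℕ} (H : Space n → ℝ) (τ τ' : ℝ) : Measure (Space n × Space n) :=
  (gibbs H τ).prod (gibbs H τ')

/-- The invariant measure `μ = (π⁺ + π⁻) / 2` of the infinite swapping process. -/
noncomputable def invMeasure {n : ℕ} (H : Space n → ℝ) (τ₁ τ₂ : ℝ) :
    Measure (Space n × Space n) :=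
  (2⁻¹ : ℝ≥0∞) • (gibbsProd H τ₁ τ₂ + gibbsProd H τ₂ τ₁)

/-- `(g₁, g₂)` is the weak gradient `(∇_{x₁} f, ∇_{x₂} f)` of `f` on `ℝⁿ × ℝⁿ` with respect to
Lebesgue measure: integration by parts holds in every direction `(v, w)` against every smooth
compactly supported test function. -/
structure IsWeakGradient {n : ℕ} (f : Space n × Space n → ℝ)
    (g₁ g₂ : Space n × Space n → Space n) : Prop where
  locallyIntegrable : LocallyIntegrable f volume
  locallyIntegrable₁ : LocallyIntegrable g₁ volume
  locallyIntegrable₂ : LocallyIntegrable g₂ volume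
  integral_by_parts : ∀ φ : Space n × Space n → ℝ, ContDiff ℝ ∞ φ → HasCompactSupport φ →
    ∀ v w : Space n,
      ∫ z, f z * fderiv ℝ φ z (v, w) = -∫ z, (inner ℝ (g₁ z) v + inner ℝ (g₂ z) w) * φ z

/-- `f ∈ H¹(μ)` with weak gradient `(g₁, g₂)`: `f`, `g₁` and `g₂` are square integrable with
respect to `μ`. -/
structure MemH1 {n : ℕ} (μ : Measure (Space n × Space n)) (f : Space n × Space n → ℝ)
    (g₁ g₂ : Space n × Space n → Space n) : Prop where
  weakGradient : IsWeakGradient f g₁ g₂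
  memLp : MemLp f 2 μ
  memLp₁ : MemLp g₁ 2 μ
  memLp₂ : MemLp g₂ 2 μ

/-- The Dirichlet form `𝓔_μ(f) = (𝓔_{π⁺}(f) + 𝓔_{π⁻}(f)) / 2` of the infinite swapping process, in
terms of the gradient `(g₁, g₂)` of `f`, where
`𝓔_{π⁺}(f) = ∫ (τ₁ |∇_{x₁} f|² + τ₂ |∇_{x₂} f|²) dπ⁺` and
`𝓔_{π⁻}(f) = ∫ (τ₂ |∇_{x₁} f|² + τ₁ |∇_{x₂} f|²) dπ⁻`. -/
noncomputable def dirichletForm {n : ℕ} (H : Space n → ℝ) (τ₁ τ₂ : ℝ)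
    (g₁ g₂ : Space n × Space n → Space n) : ℝ :=
  (1 / 2) * ∫ z, (τ₁ * ‖g₁ z‖ ^ 2 + τ₂ * ‖g₂ z‖ ^ 2) ∂(gibbsProd H τ₁ τ₂) +
    (1 / 2) * ∫ z, (τ₂ * ‖g₁ z‖ ^ 2 + τ₁ * ‖g₂ z‖ ^ 2) ∂(gibbsProd H τ₂ τ₁)

/-- The inverse spectral gap `sup_{f ∈ H¹(μ)} Var_μ(f) / 𝓔_μ(f)`, where the supremum is over the
`f ∈ H¹(μ)` for which the quotient makes sense, i.e. `𝓔_μ(f) > 0`. Since the weak gradient of `f`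
is unique almost everywhere, ranging over `f` together with its weak gradient does not change the
supremum. It is taken in `[0, ∞]`. -/
noncomputable def invSpectralGap {n : ℕ} (H : Space n → ℝ) (τ₁ τ₂ : ℝ) : ℝ≥0∞ :=
  ⨆ (f : Space n × Space n → ℝ) (g₁ : Space n × Space n → Space n)
    (g₂ : Space n × Space n → Space n) (_ : MemH1 (invMeasure H τ₁ τ₂) f g₁ g₂)
    (_ : 0 < dirichletForm H τ₁ τ₂ g₁ g₂),
    ENNReal.ofReal (variance f (invMeasure H τ₁ τ₂) / dirichletForm H τ₁ τ₂ g₁ g₂)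

end InfSwap

/-! Functions of the first particle alone already give the bound. For `f (x₁, x₂) = φ x₁`, the first
marginal of `μ` is the mean of `ν^τ₁` and `ν^τ₂`, so the variance is at least a quarter of the
squared difference of the two means of `φ`. The first coordinate diffuses at temperature `τ₁` under
`π⁺` and `τ₂` under `π⁻`, so the Dirichlet form is the mean of the two one-particle energies
(`le_invSpectralGap`).

At low temperature `ν^τ` lives at distance of order `√τ` from the minimum `m`: balls of radius `ρ`
have mass `O((ρ/√τ)^n)` and tails are exponential (`exists_concentrates`). A cutoff at radius `r`
with `√τ₁ ≪ r ≪ √τ₂` therefore has mean at least 3/4 under `ν^τ₁` and at most 1/4 under `ν^τ₂`. Its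
energy is of order at most `exp (-α r/√τ₁)` at `τ₁`, and `τ₂ r⁻² (r/√τ₂)^n = (r/√τ₂)^(n-2)` at `τ₂`
(`energy_cutoff_add_le`).

Put `s = τ₂/τ₁`. If `n ≥ 3`, taking `r = K s^(η/2) √τ₁` makes the second term a multiple of
`s^(-(1-η)(n-2)/2)`, and the first decays faster than any power of `s`. If `n = 2`, a single cutoff
only has bounded energy. Averaging cutoffs over `J ≳ log s` dyadic radii keeps the means separated,
and since the gradients have disjoint supports the energy drops to `O(1/J)`. -/

namespace InfSwap

/-! ### Growth of the potential away from its minimum -/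

section Potential

open Metric Topology

variable {n : ℕ} {H : Space n → ℝ}

theorem norm_gradient_eq (f : Space n → ℝ) (x : Space n) : ‖gradient f x‖ = ‖fderiv ℝ f x‖ := by
  simp [gradient]

/-- A nonnegative function whose gradient is bounded below on a ball is bounded below at the
centre of the ball. -/
theorem mul_radius_le_of_le_norm_gradient (hd : Differentiable ℝ H) (h0 : ∀ x, 0 ≤ H x)
    {x : Space n} {ρ G : ℝ} (hρ : 0 < ρ) (hG : 0 < G)
    (h : ∀ y ∈ ball x ρ, G ≤ ‖gradient H y‖) : G * ρ / 2 ≤ H x := by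
  -- Minimise `H` plus the penalty `k‖y - x‖²` on the closed ball. At an interior minimiser `‖∇H‖ =
  -- 2k‖y - x‖ < 2kρ = G`, which is excluded; at a boundary one the penalty alone is `kρ² = Gρ/2`.
  set k : ℝ := G / (2 * ρ) with hk
  have hk0 : 0 < k := by positivity
  have hkρ : 2 * k * ρ = G := by rw [hk]; field_simp
  obtain ⟨y, hy, hmin⟩ := (isCompact_closedBall x ρ).exists_isMinOn ⟨x, by simp [hρ.le]⟩
    (f := fun y => H y + k * ‖y - x‖ ^ 2) (by
      have := hd.continuous
      fun_prop)
  have hx : H y + k * ‖y - x‖ ^ 2 ≤ H x := by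
    simpa using hmin (mem_closedBall_self hρ.le)
  rcases (mem_closedBall.1 hy).lt_or_eq with hlt | heq
  · exfalso
    have hloc : IsLocalMin (fun y => H y + k * ‖y - x‖ ^ 2) y :=
      hmin.isLocalMin (closedBall_mem_nhds_of_mem (mem_ball.2 hlt))
    have hder : HasFDerivAt (fun y => H y + k * ‖y - x‖ ^ 2)
        (fderiv ℝ H y + k • (2 • (innerSL ℝ (y - x)))) y := by
      have h1 := ((hasFDerivAt_id y).sub_const x).norm_sq
      exact (hd y).hasFDerivAt.add (h1.const_mul k)
    have hz := hloc.hasFDerivAt_eq_zero hder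
    have hn : ‖fderiv ℝ H y‖ = k * (2 * ‖y - x‖) := by
      rw [eq_neg_of_add_eq_zero_left hz, norm_neg, norm_smul, ← Nat.cast_smul_eq_nsmul ℝ,
        norm_smul, innerSL_apply_norm]
      simp [abs_of_pos hk0]
    have := h y (mem_ball.2 hlt)
    rw [norm_gradient_eq, hn] at this
    rw [dist_eq_norm] at hlt
    nlinarith
  · rw [dist_eq_norm] at heq
    rw [heq] at hx
    have := h0 y
    nlinarith

theorem GrowthAssumption.differentiable (hH : GrowthAssumption H) : Differentiable ℝ H :=
  hH.contDiff.differentiable (by norm_num)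

theorem GrowthAssumption.differentiable_gradient (hH : GrowthAssumption H) :
    Differentiable ℝ (gradient H) := by
  have h : ContDiff ℝ 2 (fderiv ℝ H) := hH.contDiff.fderiv_right (by norm_num)
  have h' : Differentiable ℝ (fderiv ℝ H) := h.differentiable (by norm_num)
  exact (InnerProductSpace.toDual ℝ (Space n)).symm.toContinuousLinearEquiv.differentiable.comp h'

/-- Near a global minimum, the norm of the gradient is comparable to the distance. -/
theorem GrowthAssumption.gradient_near_min (hH : GrowthAssumption H) {m : Space n}
    (hm : H m = 0) : ∃ c b δ : ℝ, 0 < c ∧ 0 < b ∧ 0 < δ ∧ ∀ x, ‖x - m‖ < δ →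
      c * ‖x - m‖ ≤ ‖gradient H x‖ ∧ ‖gradient H x‖ ≤ b * ‖x - m‖ := by
  obtain ⟨C, hC, hmorse⟩ := hH.morse
  have hC0 : 0 < C := by linarith
  have hmin : IsLocalMin H m := Eventually.of_forall fun x => by rw [hm]; exact hH.nonneg x
  have hg : gradient H m = 0 := by
    rw [← norm_eq_zero, norm_gradient_eq, hmin.fderiv_eq_zero, norm_zero]
  have hA : HasFDerivAt (gradient H) (hessian H m) m := (hH.differentiable_gradient m).hasFDerivAt
  -- The remainder of the first-order expansion of `∇H` at `m` is allowed half of the Morse lower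
  -- bound `1 / C`.
  have hlittle := hA.isLittleO.def (c := 1 / (2 * C)) (by positivity)
  obtain ⟨δ, hδ, hball⟩ := Metric.eventually_nhds_iff.1 hlittle
  refine ⟨1 / (2 * C), C + 1 / (2 * C), δ, by positivity, by positivity, hδ, fun x hx => ?_⟩
  have h1 := hball (y := x) (by rwa [dist_eq_norm])
  rw [hg, sub_zero] at h1
  obtain ⟨h2, h3⟩ := hmorse m hg (x - m)
  have h4 := norm_sub_norm_le (hessian H m (x - m)) (gradient H x)
  have h5 := norm_sub_norm_le (gradient H x) (hessian H m (x - m))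
  rw [norm_sub_rev] at h4
  have h6 : ‖x - m‖ / C = 1 / (2 * C) * ‖x - m‖ + 1 / (2 * C) * ‖x - m‖ := by field_simp; norm_num
  constructor <;> linarith

/-- Quadratic upper bound near the minimum. -/
theorem GrowthAssumption.le_sq_near_min (hH : GrowthAssumption H) {m : Space n}
    (hm : H m = 0) : ∃ b δ : ℝ, 0 < b ∧ 0 < δ ∧ ∀ x, ‖x - m‖ < δ → H x ≤ b * ‖x - m‖ ^ 2 := by
  obtain ⟨c, b, δ, -, hb, hδ, h⟩ := hH.gradient_near_min hm
  refine ⟨b, δ, hb, hδ, fun x hx => ?_⟩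
  have hmv := (convex_closedBall m ‖x - m‖).norm_image_sub_le_of_norm_fderiv_le (𝕜 := ℝ) (f := H)
    (C := b * ‖x - m‖) (x := m) (y := x) (fun y _ => hH.differentiable y) (fun y hy => by
      rw [mem_closedBall, dist_eq_norm] at hy
      rw [← norm_gradient_eq]
      exact (h y (hy.trans_lt hx)).2.trans (by gcongr)) (by simp) (by simp [dist_eq_norm])
  rw [hm, sub_zero] at hmv
  calc H x ≤ ‖H x‖ := le_abs_self _
    _ ≤ _ := hmv
    _ = _ := by ring

/-- Quadratic lower bound near the minimum. -/
theorem GrowthAssumption.sq_le_near_min (hH : GrowthAssumption H) {m : Space n}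
    (hm : H m = 0) : ∃ a δ : ℝ, 0 < a ∧ 0 < δ ∧ ∀ x, ‖x - m‖ < δ → a * ‖x - m‖ ^ 2 ≤ H x := by
  obtain ⟨c, b, δ, hc, -, hδ, h⟩ := hH.gradient_near_min hm
  -- On the ball of radius `‖x - m‖ / 2` about `x` the distance to `m` stays between 1/2 and 3/2 of
  -- `‖x - m‖`, so it remains below `δ` and the gradient is at least `c‖x - m‖ / 2`.
  refine ⟨c / 8, δ / 2, by positivity, by positivity, fun x hx => ?_⟩
  rcases eq_or_ne x m with rfl | hne
  · simp [hm]
  have hd : 0 < ‖x - m‖ := norm_pos_iff.2 (sub_ne_zero.2 hne)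
  have := mul_radius_le_of_le_norm_gradient hH.differentiable hH.nonneg (x := x)
    (ρ := ‖x - m‖ / 2) (G := c * (‖x - m‖ / 2)) (by positivity) (by positivity) (fun y hy => by
      rw [mem_ball, dist_eq_norm] at hy
      have h1 := norm_add_le (y - x) (x - m)
      have h2 := norm_sub_le (y - m) (y - x)
      rw [sub_add_sub_cancel] at h1
      rw [sub_sub_sub_cancel_left] at h2
      refine le_trans ?_ (h y (by linarith)).1
      gcongr
      linarith)
  nlinarith

/-- Linear growth at infinity. -/
theorem GrowthAssumption.linear_growth (hH : GrowthAssumption H) (m : Space n) :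
    ∃ a R : ℝ, 0 < a ∧ 0 < R ∧ ∀ x, R ≤ ‖x - m‖ → a * ‖x - m‖ ≤ H x := by
  obtain ⟨C, hC, hlim⟩ := hH.gradient_growth
  have hev := eventually_lt_of_lt_liminf (lt_of_lt_of_le
    (EReal.coe_lt_coe_iff.2 (half_lt_self hC)) hlim)
  obtain ⟨R, -, hR⟩ := (hasBasis_cobounded_compl_closedBall m).eventually_iff.1 hev
  -- The factor 2 keeps the ball of radius `‖x - m‖ / 2` about `x` in the region where the gradient
  -- exceeds `C / 2`.
  refine ⟨C / 8, 2 * max R 1, by positivity, by positivity, fun x hx => ?_⟩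
  have hR1 := le_max_left R 1
  have hR2 := le_max_right R 1
  have := mul_radius_le_of_le_norm_gradient hH.differentiable hH.nonneg (x := x)
    (ρ := ‖x - m‖ / 2) (G := C / 2) (by linarith) (by positivity) (fun y hy => by
      rw [mem_ball, dist_eq_norm] at hy
      have h2 := norm_sub_le (y - m) (y - x)
      rw [sub_sub_sub_cancel_left] at h2
      have := hR (x := y) (by
        simp only [Set.mem_compl_iff, mem_closedBall, dist_eq_norm, not_le]
        linarith)
      exact (EReal.coe_lt_coe_iff.1 this).le)
  linarith

/-- Global lower bound: quadratic near the minimum, linear away from it. -/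
theorem GrowthAssumption.lower_bound (hH : GrowthAssumption H) {m : Space n}
    (hm : H m = 0) (hpos : ∀ x, x ≠ m → 0 < H x) :
    ∃ a : ℝ, 0 < a ∧ ∀ x, a * ‖x - m‖ ^ 2 ≤ H x ∨ a * ‖x - m‖ ≤ H x := by
  obtain ⟨a₁, δ, ha₁, hδ, h₁⟩ := hH.sq_le_near_min hm
  obtain ⟨a₂, R, ha₂, hR, h₂⟩ := hH.linear_growth m
  have hK : IsCompact (closedBall m R ∩ {x | δ ≤ ‖x - m‖}) :=
    (isCompact_closedBall m R).inter_right (isClosed_le (by fun_prop) (by fun_prop))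
  obtain ⟨e, he, h₃⟩ : ∃ e > 0, ∀ x ∈ closedBall m R ∩ {x | δ ≤ ‖x - m‖}, e ≤ H x :=
    hK.exists_forall_le' hH.differentiable.continuous.continuousOn fun x hx => hpos x (by
      rintro rfl
      simp at hx
      linarith [hx.2])
  refine ⟨min a₁ (min a₂ (e / R)), by positivity, fun x => ?_⟩
  rcases lt_or_ge ‖x - m‖ δ with hx | hx
  · left
    refine le_trans ?_ (h₁ x hx)
    gcongr
    exact min_le_left _ _
  · right
    rcases le_or_gt R ‖x - m‖ with hx' | hx'
    · refine le_trans ?_ (h₂ x hx')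
      gcongr
      exact (min_le_right _ _).trans (min_le_left _ _)
    · calc min a₁ (min a₂ (e / R)) * ‖x - m‖ ≤ e / R * R := by
            gcongr
            exact (min_le_right _ _).trans (min_le_right _ _)
        _ = e := by field_simp
        _ ≤ H x := h₃ x ⟨by rw [mem_closedBall, dist_eq_norm]; exact hx'.le, hx⟩

end Potential

end InfSwap

namespace InfSwap

/-! ### Concentration of the Gibbs measure at scale `√τ` -/

section Concentration

open Metric Topology Module

variable {n : ℕ} {H : Space n → ℝ}

theorem integrable_exp_neg_mul_norm {E : Type*} [NormedAddCommGroup E] [NormedSpace ℝ E]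
    [FiniteDimensional ℝ E] [MeasurableSpace E] [BorelSpace E] (μ : Measure E)
    [μ.IsAddHaarMeasure] {c : ℝ} (hc : 0 < c) : Integrable (fun x : E => Real.exp (-c * ‖x‖)) μ := by
  set N := finrank ℝ E + 1 with hN
  have hint : Integrable (fun x : E => (1 + ‖x‖) ^ (-(N : ℝ))) μ :=
    integrable_one_add_norm (by rw [hN]; push_cast; linarith)
  refine (hint.const_mul (Real.exp c * (N.factorial / c ^ N))).mono'
    (by fun_prop) (Eventually.of_forall fun x => ?_)
  have h1 := Real.pow_div_factorial_le_exp (c * (1 + ‖x‖)) (by positivity) N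
  have hpos : 0 < 1 + ‖x‖ := by positivity
  rw [Real.norm_of_nonneg (Real.exp_nonneg _), Real.rpow_neg hpos.le, Real.rpow_natCast]
  have h2 : Real.exp (-c * ‖x‖) = Real.exp c * (Real.exp (c * (1 + ‖x‖)))⁻¹ := by
    rw [← Real.exp_neg, ← Real.exp_add]; ring_nf
  rw [h2, mul_assoc]
  gcongr
  calc (Real.exp (c * (1 + ‖x‖)))⁻¹ ≤ ((c * (1 + ‖x‖)) ^ N / N.factorial)⁻¹ := by gcongr
    _ = _ := by rw [mul_pow]; field_simp

/-- With `t = ‖x - m‖ / √τ`, both growth alternatives give `H x / τ ≥ a (t - 1)`: the quadratic one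
because `t² ≥ t - 1`, the linear one because `√τ ≤ 1`. After rescaling by `√τ` the bound no longer
depends on `τ`. -/
theorem boltzmann_le {a τ : ℝ} {m : Space n} (ha : 0 < a)
    (hH : ∀ x, a * ‖x - m‖ ^ 2 ≤ H x ∨ a * ‖x - m‖ ≤ H x) (hτ : 0 < τ) (hτ1 : τ ≤ 1)
    (x : Space n) :
    Real.exp (-H x / τ) ≤ Real.exp a * Real.exp (-a * ‖(√τ)⁻¹ • (x - m)‖) := by
  have hs : 0 < √τ := Real.sqrt_pos.2 hτ
  have hs1 : √τ ≤ 1 := Real.sqrt_le_one.2 hτ1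
  have hsq : √τ * √τ = τ := Real.mul_self_sqrt hτ.le
  rw [← Real.exp_add, norm_smul, norm_inv, Real.norm_of_nonneg hs.le]
  gcongr
  have key : a * ((√τ)⁻¹ * ‖x - m‖) - a ≤ H x / τ := by
    rw [le_div_iff₀ hτ]
    have e1 : (a * ((√τ)⁻¹ * ‖x - m‖) - a) * τ = a * (√τ * ‖x - m‖ - τ) := by
      nth_rewrite 2 [← hsq]
      field_simp
      linear_combination -hsq
    rw [e1]
    rcases hH x with h | h
    · refine le_trans ?_ h
      gcongr
      nlinarith [sq_nonneg (√τ - ‖x - m‖), sq_nonneg (√τ + ‖x - m‖)]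
    · refine le_trans ?_ h
      gcongr
      nlinarith [norm_nonneg (x - m)]
  rw [neg_div]
  linarith

theorem integrable_exp_neg_mul_norm_scaled {c s : ℝ} (hc : 0 < c) (hs : 0 < s) (m : Space n) :
    Integrable (fun x : Space n => Real.exp (-c * ‖s⁻¹ • (x - m)‖)) := by
  have h := (integrable_exp_neg_mul_norm (volume : Measure (Space n)) hc).comp_smul
    (R := s⁻¹) (by positivity)
  exact h.comp_sub_right m

theorem integral_exp_neg_mul_norm_scaled {c s : ℝ} (hs : 0 < s) (m : Space n) :
    ∫ x : Space n, Real.exp (-c * ‖s⁻¹ • (x - m)‖) =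
      s ^ n * ∫ x : Space n, Real.exp (-c * ‖x‖) := by
  rw [integral_sub_right_eq_self (fun x : Space n => Real.exp (-c * ‖s⁻¹ • x‖)) m,
    Measure.integral_comp_inv_smul_of_nonneg _ (fun x : Space n => Real.exp (-c * ‖x‖)) hs.le]
  simp

theorem volume_real_closedBall (m : Space n) {ρ : ℝ} (hρ : 0 ≤ ρ) :
    (volume : Measure (Space n)).real (closedBall m ρ) =
      ρ ^ n * (volume : Measure (Space n)).real (ball 0 1) := by
  rw [measureReal_def, Measure.addHaar_closedBall _ _ hρ, ENNReal.toReal_mul,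
    ENNReal.toReal_ofReal (by positivity), measureReal_def]
  simp

theorem gibbs_real_apply (τ : ℝ) {s : Set (Space n)} (hs : MeasurableSet s) :
    (gibbs H τ).real s = (∫ x in s, Real.exp (-H x / τ)) / ∫ x, Real.exp (-H x / τ) := by
  rw [measureReal_def, gibbs, tilted_apply_eq_ofReal_integral' _ hs, ENNReal.toReal_ofReal]
  · rw [integral_div]
  · exact integral_nonneg fun x => by positivity

/-- At low temperature the Gibbs measure concentrates around the minimum at scale `√τ`: balls of
radius `ρ` have mass at most of order `(ρ / √τ) ^ n`, and tails decay exponentially. -/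
structure Concentrates (H : Space n → ℝ) (m : Space n) (D α τ : ℝ) : Prop where
  isProbabilityMeasure : IsProbabilityMeasure (gibbs H τ)
  absolutelyContinuous : volume ≪ gibbs H τ
  ball_le : ∀ ρ : ℝ, 0 ≤ ρ → (gibbs H τ).real (closedBall m ρ) ≤ D * (ρ / √τ) ^ n
  tail_le : ∀ K : ℝ, 0 ≤ K →
    (gibbs H τ).real {x | K * √τ ≤ ‖x - m‖} ≤ D * Real.exp (-α * K)

/-- The quadratic upper bound on the ball of radius `√τ` makes the partition function at least a
multiple of `√τ ^ n`. The ball bound then needs only `H ≥ 0`, and the tail bound needs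
`boltzmann_le`. -/
theorem exists_concentrates (hH : GrowthAssumption H) {m : Space n} (hm : H m = 0)
    (hpos : ∀ x, x ≠ m → 0 < H x) :
    ∃ D α τ₀ : ℝ, 0 < D ∧ 0 < α ∧ 0 < τ₀ ∧ ∀ τ, 0 < τ → τ ≤ τ₀ → Concentrates H m D α τ := by
  obtain ⟨a, ha, hlow⟩ := hH.lower_bound hm hpos
  obtain ⟨b, δ, hb, hδ, hup⟩ := hH.le_sq_near_min hm
  set v : ℝ := (volume : Measure (Space n)).real (ball 0 1) with hv
  have hv0 : 0 < v := by
    rw [hv, measureReal_def]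
    exact ENNReal.toReal_pos (measure_ball_pos _ _ one_pos).ne' measure_ball_lt_top.ne
  set I : ℝ := ∫ x : Space n, Real.exp (-(a / 2) * ‖x‖) with hI
  have hI0 : 0 ≤ I := integral_nonneg fun x => by positivity
  have hcont : Continuous H := hH.differentiable.continuous
  -- The two summands are the constants of the ball and tail bounds. The threshold ensures `τ ≤ 1`
  -- and `√τ < δ`.
  refine ⟨Real.exp b + Real.exp b / v * (Real.exp a * I), a / 2, min 1 ((δ / 2) ^ 2),
    by positivity, by positivity, by positivity, fun τ hτ hττ => ?_⟩
  have hτ1 : τ ≤ 1 := hττ.trans (min_le_left _ _)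
  have hs : 0 < √τ := Real.sqrt_pos.2 hτ
  have hsδ : √τ < δ := by
    have : √τ ≤ δ / 2 := Real.sqrt_le_iff.2 ⟨by positivity, hττ.trans (min_le_right _ _)⟩
    linarith
  have hint : Integrable (fun x : Space n => Real.exp (-H x / τ)) := by
    refine ((integrable_exp_neg_mul_norm_scaled ha hs m).const_mul (Real.exp a)).mono'
      (by fun_prop) (Eventually.of_forall fun x => ?_)
    rw [Real.norm_of_nonneg (Real.exp_nonneg _)]
    exact boltzmann_le ha hlow hτ hτ1 x
  set Z : ℝ := ∫ x, Real.exp (-H x / τ) with hZ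
  have hZlow : Real.exp (-b) * (√τ ^ n * v) ≤ Z := by
    rw [← volume_real_closedBall m hs.le]
    calc Real.exp (-b) * (volume : Measure (Space n)).real (closedBall m √τ)
        = ∫ x in closedBall m √τ, Real.exp (-b) := by
          rw [setIntegral_const, smul_eq_mul, mul_comm]
      _ ≤ ∫ x in closedBall m √τ, Real.exp (-H x / τ) := by
          refine setIntegral_mono_on (by
            rw [integrableOn_const_iff]; right; exact measure_closedBall_lt_top)
            hint.integrableOn measurableSet_closedBall fun x hx => ?_
          rw [mem_closedBall, dist_eq_norm] at hx
          gcongr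
          rw [neg_div, neg_le_neg_iff, div_le_iff₀ hτ]
          refine (hup x (hx.trans_lt hsδ)).trans ?_
          gcongr
          calc ‖x - m‖ ^ 2 ≤ √τ ^ 2 := by gcongr
            _ = τ := Real.sq_sqrt hτ.le
      _ ≤ Z := setIntegral_le_integral hint (Eventually.of_forall fun x => by positivity)
  have hZ0 : 0 < Z := lt_of_lt_of_le (by positivity) hZlow
  have hquot : ∀ w : ℝ, 0 ≤ w → w / Z ≤ Real.exp b / v * (w / √τ ^ n) := fun w hw => by
    calc w / Z ≤ w / (Real.exp (-b) * (√τ ^ n * v)) := by gcongr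
      _ = _ := by rw [Real.exp_neg]; field_simp
  refine ⟨isProbabilityMeasure_tilted hint, absolutelyContinuous_tilted hint, fun ρ hρ => ?_,
    fun K hK => ?_⟩
  · have h1 : ∫ x in closedBall m ρ, Real.exp (-H x / τ) ≤ ρ ^ n * v := by
      rw [← volume_real_closedBall m hρ]
      calc ∫ x in closedBall m ρ, Real.exp (-H x / τ) ≤ ∫ x in closedBall m ρ, (1 : ℝ) := by
            refine setIntegral_mono_on hint.integrableOn (by
              rw [integrableOn_const_iff]; right; exact measure_closedBall_lt_top)
              measurableSet_closedBall fun x _ => ?_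
            rw [Real.exp_le_one_iff, neg_div, neg_nonpos]
            exact div_nonneg (hH.nonneg x) hτ.le
        _ = _ := by simp
    rw [gibbs_real_apply _ measurableSet_closedBall, ← hZ]
    calc _ ≤ ρ ^ n * v / Z := by gcongr
      _ ≤ _ := hquot _ (by positivity)
      _ = Real.exp b * (ρ / √τ) ^ n := by rw [div_pow]; field_simp
      _ ≤ _ := by
        gcongr
        exact le_add_of_nonneg_right (by positivity)
  · have hms : MeasurableSet {x : Space n | K * √τ ≤ ‖x - m‖} :=
      measurableSet_le (by fun_prop) (by fun_prop)
    -- Half of the decay rate `a` pays for the factor `exp (-(a / 2) K)`; the other half keeps the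
    -- integral finite.
    have hint2 := (integrable_exp_neg_mul_norm_scaled (half_pos ha) hs m).const_mul
      (Real.exp a * Real.exp (-(a / 2) * K))
    have h1 : ∫ x in {x : Space n | K * √τ ≤ ‖x - m‖}, Real.exp (-H x / τ) ≤
        Real.exp a * Real.exp (-(a / 2) * K) * (√τ ^ n * I) := by
      rw [hI, ← integral_exp_neg_mul_norm_scaled hs m, ← integral_const_mul]
      refine (setIntegral_mono_on hint.integrableOn hint2.integrableOn hms fun x hx => ?_).trans
        (setIntegral_le_integral hint2 (Eventually.of_forall fun x => by positivity))
      refine (boltzmann_le ha hlow hτ hτ1 x).trans ?_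
      rw [mul_assoc, ← Real.exp_add (-(a / 2) * K)]
      gcongr
      have : K ≤ ‖(√τ)⁻¹ • (x - m)‖ := by
        rw [norm_smul, norm_inv, Real.norm_of_nonneg hs.le, inv_mul_eq_div, le_div_iff₀ hs]
        exact hx
      nlinarith
    rw [gibbs_real_apply _ hms, ← hZ]
    calc _ ≤ Real.exp a * Real.exp (-(a / 2) * K) * (√τ ^ n * I) / Z := by gcongr
      _ ≤ _ := hquot _ (by positivity)
      _ = Real.exp b / v * (Real.exp a * I) * Real.exp (-(a / 2) * K) := by field_simp
      _ ≤ _ := by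
        gcongr
        exact le_add_of_nonneg_left (by positivity)

end Concentration

end InfSwap

namespace InfSwap

/-! ### Test functions depending on one particle -/

section TestFunction

open Metric Topology

variable {n : ℕ} {H : Space n → ℝ}

theorem continuous_gradient {φ : Space n → ℝ} (hφ : ContDiff ℝ 1 φ) : Continuous (gradient φ) :=
  (InnerProductSpace.toDual ℝ (Space n)).symm.continuous.comp (hφ.continuous_fderiv (by norm_num))

theorem inner_gradient (φ : Space n → ℝ) (x v : Space n) :
    inner ℝ (gradient φ x) v = fderiv ℝ φ x v := by
  simp [gradient]

theorem hasCompactSupport_gradient {φ : Space n → ℝ} (hc : HasCompactSupport φ) :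
    HasCompactSupport (gradient φ) :=
  (hc.fderiv ℝ).comp_left (g := (InnerProductSpace.toDual ℝ (Space n)).symm) (map_zero _)

/-- A function of the first particle has weak gradient concentrated on the first particle. -/
theorem isWeakGradient_fst {φ : Space n → ℝ} (hφ : ContDiff ℝ 1 φ) :
    IsWeakGradient (fun z : Space n × Space n => φ z.1) (fun z => gradient φ z.1)
      (fun _ => 0) where
  locallyIntegrable := (hφ.continuous.comp continuous_fst).locallyIntegrable
  locallyIntegrable₁ := ((continuous_gradient hφ).comp continuous_fst).locallyIntegrable
  locallyIntegrable₂ := continuous_const.locallyIntegrable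
  integral_by_parts := fun ψ hψ hc v w => by
    have hF : ContDiff ℝ 1 (fun z : Space n × Space n => φ z.1) := hφ.comp contDiff_fst
    have hd : ∀ z : Space n × Space n, fderiv ℝ (fun z : Space n × Space n => φ z.1) z (v, w) =
        inner ℝ (gradient φ z.1) v + inner ℝ (0 : Space n) w := fun z => by
      have h := ((hφ.differentiable (by norm_num) z.1).hasFDerivAt.comp z
        (hasFDerivAt_fst (𝕜 := ℝ) (E := Space n) (F := Space n)))
      rw [inner_zero_left, add_zero, inner_gradient]
      exact congrArg (fun L => L (v, w)) h.fderiv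
    have hψ1 : ContDiff ℝ 1 ψ := hψ.of_le (by norm_cast)
    have hcf : Continuous fun z => fderiv ℝ (fun z : Space n × Space n => φ z.1) z (v, w) :=
      (hF.continuous_fderiv (by norm_num)).clm_apply continuous_const
    have hcg : Continuous fun z => fderiv ℝ ψ z (v, w) :=
      (hψ1.continuous_fderiv (by norm_num)).clm_apply continuous_const
    have : (volume : Measure (Space n × Space n)).IsAddHaarMeasure := by
      rw [Measure.volume_eq_prod]
      infer_instance
    have := integral_mul_fderiv_eq_neg_fderiv_mul_of_integrable (𝕜 := ℝ)
      (μ := (volume : Measure (Space n × Space n)))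
      (f := fun z : Space n × Space n => φ z.1) (g := ψ) (v := (v, w))
      ((hcf.mul hψ.continuous).integrable_of_hasCompactSupport hc.mul_left)
      ((hF.continuous.mul hcg).integrable_of_hasCompactSupport
        (hc.fderiv_apply ℝ (v, w)).mul_left)
      ((hF.continuous.mul hψ.continuous).integrable_of_hasCompactSupport hc.mul_left)
      (fun z _ => hF.differentiable (by norm_num) z)
      (fun z _ => hψ1.differentiable (by norm_num) z)
    simp only [hd] at this
    exact this

theorem integral_gibbsProd_fst {τ τ' : ℝ} [IsProbabilityMeasure (gibbs H τ)]
    [IsProbabilityMeasure (gibbs H τ')] (g : Space n → ℝ) :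
    ∫ z, g z.1 ∂(gibbsProd H τ τ') = ∫ x, g x ∂(gibbs H τ) := by
  rw [gibbsProd, integral_fun_fst]
  simp

/-- The contribution of temperature `τ` to the Dirichlet form of a function of one particle. -/
noncomputable def energy (H : Space n → ℝ) (τ : ℝ) (φ : Space n → ℝ) : ℝ :=
  τ * ∫ x, ‖gradient φ x‖ ^ 2 ∂(gibbs H τ)

theorem energy_nonneg {τ : ℝ} (hτ : 0 ≤ τ) (φ : Space n → ℝ) : 0 ≤ energy H τ φ :=
  mul_nonneg hτ (integral_nonneg fun x => by positivity)

theorem dirichletForm_fst {τ₁ τ₂ : ℝ} [IsProbabilityMeasure (gibbs H τ₁)]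
    [IsProbabilityMeasure (gibbs H τ₂)] (φ : Space n → ℝ) :
    dirichletForm H τ₁ τ₂ (fun z => gradient φ z.1) (fun _ => 0) =
      (energy H τ₁ φ + energy H τ₂ φ) / 2 := by
  have h1 := integral_gibbsProd_fst (H := H) (τ := τ₁) (τ' := τ₂)
    (fun x => τ₁ * ‖gradient φ x‖ ^ 2)
  have h2 := integral_gibbsProd_fst (H := H) (τ := τ₂) (τ' := τ₁)
    (fun x => τ₂ * ‖gradient φ x‖ ^ 2)
  simp only [dirichletForm, norm_zero, ne_eq, OfNat.ofNat_ne_zero, not_false_eq_true, zero_pow,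
    mul_zero, add_zero]
  rw [h1, h2, integral_const_mul, integral_const_mul, energy, energy]
  ring

instance isProbabilityMeasure_invMeasure {τ₁ τ₂ : ℝ} [IsProbabilityMeasure (gibbs H τ₁)]
    [IsProbabilityMeasure (gibbs H τ₂)] : IsProbabilityMeasure (invMeasure H τ₁ τ₂) := by
  refine ⟨?_⟩
  simp only [invMeasure, gibbsProd, Measure.smul_apply, Measure.add_apply, measure_univ,
    smul_eq_mul]
  rw [one_add_one_eq_two, ENNReal.inv_mul_cancel two_ne_zero ENNReal.ofNat_ne_top]

theorem integral_invMeasure_fst {τ₁ τ₂ : ℝ} [IsProbabilityMeasure (gibbs H τ₁)]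
    [IsProbabilityMeasure (gibbs H τ₂)] {g : Space n → ℝ} (hg : Continuous g)
    (hc : HasCompactSupport g) :
    ∫ z, g z.1 ∂(invMeasure H τ₁ τ₂) =
      (∫ x, g x ∂(gibbs H τ₁) + ∫ x, g x ∂(gibbs H τ₂)) / 2 := by
  obtain ⟨C, hC⟩ := hc.exists_bound_of_continuous hg
  have hint : ∀ τ τ' : ℝ, IsProbabilityMeasure (gibbs H τ) → IsProbabilityMeasure (gibbs H τ') →
      Integrable (fun z : Space n × Space n => g z.1) (gibbsProd H τ τ') := fun τ τ' _ _ => by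
    rw [gibbsProd]
    exact Integrable.of_bound (by fun_prop) C (Eventually.of_forall fun z => hC z.1)
  rw [invMeasure, integral_smul_measure,
    integral_add_measure (hint τ₁ τ₂ ‹_› ‹_›) (hint τ₂ τ₁ ‹_› ‹_›), integral_gibbsProd_fst,
    integral_gibbsProd_fst]
  simp
  ring

/-- A test function of one particle bounds the inverse spectral gap from below. -/
theorem le_invSpectralGap {τ₁ τ₂ : ℝ} [IsProbabilityMeasure (gibbs H τ₁)]
    [IsProbabilityMeasure (gibbs H τ₂)] (hτ₁ : 0 < τ₁) (hτ₂ : 0 < τ₂)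
    (hac : volume ≪ gibbs H τ₁) {φ : Space n → ℝ} (hφ : ContDiff ℝ 1 φ)
    (hc : HasCompactSupport φ) {d B : ℝ} (hd : 0 < d)
    (hdiff : d ≤ ∫ x, φ x ∂(gibbs H τ₁) - ∫ x, φ x ∂(gibbs H τ₂))
    (hB : (energy H τ₁ φ + energy H τ₂ φ) / 2 ≤ B) :
    ENNReal.ofReal (d ^ 2 / (4 * B)) ≤ invSpectralGap H τ₁ τ₂ := by
  obtain ⟨C, hC⟩ := hc.exists_bound_of_continuous hφ.continuous
  have hgc := continuous_gradient hφ
  obtain ⟨C', hC'⟩ := (hasCompactSupport_gradient hc).exists_bound_of_continuous hgc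
  have hmem : MemLp (fun z : Space n × Space n => φ z.1) 2 (invMeasure H τ₁ τ₂) :=
    MemLp.of_bound (hφ.continuous.comp continuous_fst).aestronglyMeasurable C
      (Eventually.of_forall fun z => hC z.1)
  have hH1 : MemH1 (invMeasure H τ₁ τ₂) (fun z => φ z.1) (fun z => gradient φ z.1)
      (fun _ => 0) :=
    { weakGradient := isWeakGradient_fst hφ
      memLp := hmem
      memLp₁ := MemLp.of_bound (hgc.comp continuous_fst).aestronglyMeasurable C'
        (Eventually.of_forall fun z => hC' z.1)
      memLp₂ := MemLp.zero' }
  -- Zero energy would make `φ` constant, since Lebesgue measure is absolutely continuous with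
  -- respect to `ν^τ₁` and `∇φ` is continuous; the two means would then agree.
  have hE1 : 0 < energy H τ₁ φ := by
    refine (energy_nonneg hτ₁.le φ).lt_of_ne' fun h0 => ?_
    have hz : ∫ x, ‖gradient φ x‖ ^ 2 ∂(gibbs H τ₁) = 0 := by
      simpa [energy, hτ₁.ne'] using h0
    have hint : Integrable (fun x => ‖gradient φ x‖ ^ 2) (gibbs H τ₁) :=
      Integrable.of_bound (by fun_prop) (C' ^ 2) (Eventually.of_forall fun x => by
        rw [norm_pow, norm_norm]
        gcongr
        exact hC' x)
    rw [integral_eq_zero_iff_of_nonneg (fun x => by positivity) hint] at hz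
    have hae : gradient φ =ᵐ[volume] fun _ => 0 := by
      filter_upwards [hac.ae_le hz] with x hx
      simpa using hx
    have hall := (hgc.ae_eq_iff_eq volume continuous_const).1 hae
    have hconst : ∀ x, φ x = φ 0 := fun x =>
      is_const_of_fderiv_eq_zero (𝕜 := ℝ) (hφ.differentiable (by norm_num))
        (fun y => by rw [← norm_eq_zero, ← norm_gradient_eq, hall, norm_zero]) x 0
    simp only [hconst, integral_const, probReal_univ, one_smul, sub_self] at hdiff
    linarith
  have hE : 0 < (energy H τ₁ φ + energy H τ₂ φ) / 2 := by
    linarith [energy_nonneg (H := H) hτ₂.le φ]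
  have hsq : ∀ τ : ℝ, IsProbabilityMeasure (gibbs H τ) →
      (∫ x, φ x ∂(gibbs H τ)) ^ 2 ≤ ∫ x, φ x ^ 2 ∂(gibbs H τ) := fun τ _ => by
    have hm : MemLp φ 2 (gibbs H τ) :=
      MemLp.of_bound hφ.continuous.aestronglyMeasurable C (Eventually.of_forall hC)
    have h1 := variance_eq_sub hm
    have h2 := variance_nonneg φ (gibbs H τ)
    simp only [Pi.pow_apply] at h1
    linarith
  have hvar : d ^ 2 / 4 ≤ variance (fun z : Space n × Space n => φ z.1) (invMeasure H τ₁ τ₂) := by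
    rw [variance_eq_sub hmem]
    have h1 := integral_invMeasure_fst (H := H) (τ₁ := τ₁) (τ₂ := τ₂) (g := fun x => φ x ^ 2)
      (hφ.continuous.pow 2) (hc.comp_left (g := fun t => t ^ 2) (by simp))
    have h2 := integral_invMeasure_fst (H := H) (τ₁ := τ₁) (τ₂ := τ₂) hφ.continuous hc
    simp only [Pi.pow_apply]
    rw [h1, h2]
    have h3 := hsq τ₁ ‹_›
    have h4 := hsq τ₂ ‹_›
    -- With `p`, `q` the two means, the variance is at least `(p² + q²)/2 - ((p + q)/2)² = (p -
    -- q)²/4`.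
    have h5 : d ^ 2 ≤ (∫ x, φ x ∂(gibbs H τ₁) - ∫ x, φ x ∂(gibbs H τ₂)) ^ 2 := by gcongr
    nlinarith
  rw [invSpectralGap]
  refine le_trans ?_ (le_iSup_of_le (fun z => φ z.1) <| le_iSup_of_le (fun z => gradient φ z.1) <|
    le_iSup_of_le (fun _ => 0) <| le_iSup_of_le hH1 <|
    le_iSup_of_le (by rw [dirichletForm_fst]; exact hE) le_rfl)
  rw [dirichletForm_fst]
  refine ENNReal.ofReal_le_ofReal ?_
  rw [← div_div]
  have := variance_nonneg (fun z : Space n × Space n => φ z.1) (invMeasure H τ₁ τ₂)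
  gcongr

end TestFunction

end InfSwap

namespace InfSwap

/-! ### Radial cutoffs, their means and energies -/

section Cutoff

open Metric Topology

variable {n : ℕ} {H : Space n → ℝ}

theorem exists_bound_deriv_smoothTransition :
    ∃ M : ℝ, 0 < M ∧ ∀ t, |deriv Real.smoothTransition t| ≤ M := by
  have hc : Continuous (deriv Real.smoothTransition) :=
    (Real.smoothTransition.contDiff (n := 1)).continuous_deriv (by norm_num)
  obtain ⟨M, hM⟩ := (isCompact_Icc (a := (0 : ℝ)) (b := 1)).exists_bound_of_continuousOn
    hc.continuousOn
  refine ⟨max M 1, by positivity, fun t => ?_⟩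
  by_cases ht : t ∈ Set.Icc (0 : ℝ) 1
  · exact (hM t ht).trans (le_max_left _ _)
  · have : deriv Real.smoothTransition t = 0 := by
      rw [Set.mem_Icc, not_and_or, not_le, not_le] at ht
      rcases ht with ht | ht
      · have : Real.smoothTransition =ᶠ[𝓝 t] fun _ => 0 := by
          filter_upwards [Iio_mem_nhds ht] with s hs
          exact Real.smoothTransition.zero_of_nonpos (le_of_lt hs)
        rw [this.deriv_eq, deriv_const]
      · have : Real.smoothTransition =ᶠ[𝓝 t] fun _ => 1 := by
          filter_upwards [Ioi_mem_nhds ht] with s hs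
          exact Real.smoothTransition.one_of_one_le (le_of_lt hs)
        rw [this.deriv_eq, deriv_const]
    rw [this, abs_zero]
    positivity

/-- A smooth function equal to `1` on the ball of radius `r` around `m` and to `0` outside the
ball of radius `√2 r`. -/
noncomputable def cutoff (m : Space n) (r : ℝ) (x : Space n) : ℝ :=
  Real.smoothTransition (2 - ‖x - m‖ ^ 2 / r ^ 2)

theorem contDiff_cutoff (m : Space n) (r : ℝ) : ContDiff ℝ 1 (cutoff m r) :=
  Real.smoothTransition.contDiff.comp
    (contDiff_const.sub (((contDiff_id.sub contDiff_const).norm_sq ℝ).div_const _))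

theorem cutoff_nonneg (m : Space n) (r : ℝ) (x : Space n) : 0 ≤ cutoff m r x :=
  Real.smoothTransition.nonneg _

theorem cutoff_le_one (m : Space n) (r : ℝ) (x : Space n) : cutoff m r x ≤ 1 :=
  Real.smoothTransition.le_one _

theorem cutoff_eq_one {m : Space n} {r : ℝ} {x : Space n} (h : ‖x - m‖ ≤ r) :
    cutoff m r x = 1 := by
  refine Real.smoothTransition.one_of_one_le ?_
  have : ‖x - m‖ ^ 2 / r ^ 2 ≤ 1 := div_le_one_of_le₀ (by gcongr) (by positivity)
  linarith

/-- The constant 3/2 replaces `√2`. Being less than 2, it still makes the gradient shells at dyadic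
radii disjoint. -/
theorem cutoff_eq_zero {m : Space n} {r : ℝ} {x : Space n} (hr : 0 < r)
    (h : 3 / 2 * r < ‖x - m‖) : cutoff m r x = 0 := by
  refine Real.smoothTransition.zero_of_nonpos ?_
  have : 2 ≤ ‖x - m‖ ^ 2 / r ^ 2 := by
    rw [le_div_iff₀ (by positivity)]
    nlinarith
  linarith

theorem hasCompactSupport_cutoff (m : Space n) {r : ℝ} (hr : 0 < r) :
    HasCompactSupport (cutoff m r) :=
  HasCompactSupport.intro (isCompact_closedBall m (3 / 2 * r)) fun x hx => by
    rw [mem_closedBall, dist_eq_norm, not_le] at hx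
    exact cutoff_eq_zero hr hx

theorem gradient_eq_zero_of_eventually_const {φ : Space n → ℝ} {x : Space n} {c : ℝ}
    (h : φ =ᶠ[𝓝 x] fun _ => c) : gradient φ x = 0 := by
  rw [← norm_eq_zero, norm_gradient_eq, h.fderiv_eq]
  simp

/-- The gradient of the cutoff is supported in a shell. -/
theorem shell_of_gradient_cutoff_ne_zero {m : Space n} {r : ℝ} {x : Space n} (hr : 0 < r)
    (h : gradient (cutoff m r) x ≠ 0) : r ≤ ‖x - m‖ ∧ ‖x - m‖ ≤ 3 / 2 * r := by
  have hcont : Continuous fun y : Space n => ‖y - m‖ := by fun_prop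
  constructor
  · by_contra! hx
    refine h (gradient_eq_zero_of_eventually_const (c := 1) ?_)
    filter_upwards [hcont.continuousAt.eventually_lt_const hx] with y hy
    exact cutoff_eq_one hy.le
  · by_contra! hx
    refine h (gradient_eq_zero_of_eventually_const (c := 0) ?_)
    filter_upwards [hcont.continuousAt.eventually_const_lt hx] with y hy
    exact cutoff_eq_zero hr hy

theorem exists_norm_gradient_cutoff_le (n : ℕ) :
    ∃ M : ℝ, 0 < M ∧ ∀ (m : Space n) (r : ℝ) (x : Space n), 0 < r →
      ‖gradient (cutoff m r) x‖ ≤ M / r := by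
  obtain ⟨M, hM, hbound⟩ := exists_bound_deriv_smoothTransition
  refine ⟨3 * M, by positivity, fun m r x hr => ?_⟩
  by_cases h0 : gradient (cutoff m r) x = 0
  · rw [h0, norm_zero]
    positivity
  have hx := (shell_of_gradient_cutoff_ne_zero hr h0).2
  have hinner : HasFDerivAt (fun y : Space n => 2 - ‖y - m‖ ^ 2 * (r ^ 2)⁻¹)
      (-((r ^ 2)⁻¹ • (2 • innerSL ℝ (x - m)))) x :=
    ((((hasFDerivAt_id x).sub_const m).norm_sq).mul_const ((r ^ 2)⁻¹)).const_sub 2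
  have houter : HasDerivAt Real.smoothTransition
      (deriv Real.smoothTransition (2 - ‖x - m‖ ^ 2 * (r ^ 2)⁻¹)) (2 - ‖x - m‖ ^ 2 * (r ^ 2)⁻¹) :=
    ((Real.smoothTransition.contDiff (n := 1)).differentiable (by norm_num) _).hasDerivAt
  have hcomp := houter.comp_hasFDerivAt x hinner
  have hcut : cutoff m r = Real.smoothTransition ∘ fun y => 2 - ‖y - m‖ ^ 2 * (r ^ 2)⁻¹ := by
    ext y
    simp [cutoff, div_eq_mul_inv]
  rw [norm_gradient_eq, hcut, hcomp.fderiv, norm_smul, norm_neg, norm_smul,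
    ← Nat.cast_smul_eq_nsmul ℝ, norm_smul, innerSL_apply_norm]
  calc _ ≤ M * (‖(r ^ 2)⁻¹‖ * (‖((2 : ℕ) : ℝ)‖ * (3 / 2 * r))) := by
        gcongr
        exact hbound _
    _ = 3 * M / r := by
        rw [Real.norm_of_nonneg (by positivity)]
        simp
        field_simp

theorem Concentrates.integrable {m : Space n} {D α τ : ℝ} (h : Concentrates H m D α τ)
    {φ : Space n → ℝ} (hφ : Continuous φ) (hc : HasCompactSupport φ) :
    Integrable φ (gibbs H τ) := by
  have := h.isProbabilityMeasure
  obtain ⟨C, hC⟩ := hc.exists_bound_of_continuous hφ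
  exact Integrable.of_bound hφ.aestronglyMeasurable C (Eventually.of_forall hC)

theorem Concentrates.integrable_norm_gradient_sq {m : Space n} {D α τ : ℝ}
    (h : Concentrates H m D α τ) {φ : Space n → ℝ} (hφ : ContDiff ℝ 1 φ)
    (hc : HasCompactSupport φ) : Integrable (fun x => ‖gradient φ x‖ ^ 2) (gibbs H τ) :=
  h.integrable (by have := continuous_gradient hφ; fun_prop)
    ((hasCompactSupport_gradient hc).comp_left (g := fun v => ‖v‖ ^ 2) (by simp))

theorem energy_cutoff_le {m : Space n} {D α τ M r : ℝ} (h : Concentrates H m D α τ)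
    (hτ : 0 < τ) (hr : 0 < r) (hM : ∀ x, ‖gradient (cutoff m r) x‖ ≤ M / r) {s : Set (Space n)}
    (hs : MeasurableSet s) (hsub : ∀ x, r ≤ ‖x - m‖ → ‖x - m‖ ≤ 3 / 2 * r → x ∈ s) :
    energy H τ (cutoff m r) ≤ τ * ((M / r) ^ 2 * (gibbs H τ).real s) := by
  have := h.isProbabilityMeasure
  refine mul_le_mul_of_nonneg_left ?_ hτ.le
  calc ∫ x, ‖gradient (cutoff m r) x‖ ^ 2 ∂(gibbs H τ)
      ≤ ∫ x, s.indicator (fun _ => (M / r) ^ 2) x ∂(gibbs H τ) := by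
        refine integral_mono
          (h.integrable_norm_gradient_sq (contDiff_cutoff m r) (hasCompactSupport_cutoff m hr))
          ((integrable_const _).indicator hs) fun x => ?_
        by_cases hx : x ∈ s
        · simp only [Set.indicator_of_mem hx]
          gcongr
          exact hM x
        · have h0 : gradient (cutoff m r) x = 0 := by
            by_contra hne
            obtain ⟨h1, h2⟩ := shell_of_gradient_cutoff_ne_zero hr hne
            exact hx (hsub x h1 h2)
          simp [Set.indicator_of_notMem hx, h0]
    _ = _ := by rw [integral_indicator_const _ hs, smul_eq_mul, mul_comm]

/-- Energy of the cutoff at a temperature much larger than the squared radius. -/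
theorem energy_cutoff_le_ball {m : Space n} {D α τ M r : ℝ} (h : Concentrates H m D α τ)
    (hτ : 0 < τ) (hr : 0 < r) (hM : ∀ x, ‖gradient (cutoff m r) x‖ ≤ M / r) :
    energy H τ (cutoff m r) ≤ τ * ((M / r) ^ 2 * (D * (2 * r / √τ) ^ n)) := by
  refine (energy_cutoff_le h hτ hr hM (measurableSet_closedBall (x := m) (ε := 2 * r))
    fun x _ hx => ?_).trans ?_
  · rw [mem_closedBall, dist_eq_norm]
    linarith
  · gcongr
    exact h.ball_le _ (by positivity)

/-- Energy of the cutoff at a temperature smaller than the squared radius. -/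
theorem energy_cutoff_le_tail {m : Space n} {D α τ M r : ℝ} (h : Concentrates H m D α τ)
    (hτ : 0 < τ) (hr : 0 < r) (hM : ∀ x, ‖gradient (cutoff m r) x‖ ≤ M / r) :
    energy H τ (cutoff m r) ≤ τ * ((M / r) ^ 2 * (D * Real.exp (-α * (r / √τ)))) := by
  have hs : 0 < √τ := Real.sqrt_pos.2 hτ
  refine (energy_cutoff_le h hτ hr hM (s := {x | r / √τ * √τ ≤ ‖x - m‖})
    (measurableSet_le (by fun_prop) (by fun_prop)) fun x hx _ => ?_).trans ?_
  · simpa [div_mul_cancel₀ _ hs.ne'] using hx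
  · gcongr
    exact h.tail_le _ (by positivity)

theorem le_integral_cutoff {m : Space n} {D α τ r : ℝ} (h : Concentrates H m D α τ)
    (hτ : 0 < τ) (hr : 0 < r) :
    1 - D * Real.exp (-α * (r / √τ)) ≤ ∫ x, cutoff m r x ∂(gibbs H τ) := by
  have := h.isProbabilityMeasure
  have hs : 0 < √τ := Real.sqrt_pos.2 hτ
  have htail := h.tail_le (r / √τ) (by positivity)
  rw [div_mul_cancel₀ _ hs.ne'] at htail
  have hms : MeasurableSet {x : Space n | r ≤ ‖x - m‖} :=
    measurableSet_le (by fun_prop) (by fun_prop)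
  calc _ ≤ 1 - (gibbs H τ).real {x | r ≤ ‖x - m‖} := by linarith
    _ = (gibbs H τ).real {x | r ≤ ‖x - m‖}ᶜ := (probReal_compl_eq_one_sub hms).symm
    _ = ∫ x, {x : Space n | r ≤ ‖x - m‖}ᶜ.indicator (fun _ => (1 : ℝ)) x ∂(gibbs H τ) := by
        rw [integral_indicator_const _ hms.compl]; simp
    _ ≤ _ := by
        refine integral_mono ((integrable_const _).indicator hms.compl)
          (h.integrable (contDiff_cutoff m r).continuous (hasCompactSupport_cutoff m hr))
          fun x => ?_
        by_cases hx : r ≤ ‖x - m‖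
        · simp [hx, cutoff_nonneg]
        · simp [hx, cutoff_eq_one (not_le.1 hx).le]

theorem integral_cutoff_le {m : Space n} {D α τ r : ℝ} (h : Concentrates H m D α τ)
    (hr : 0 < r) : ∫ x, cutoff m r x ∂(gibbs H τ) ≤ D * (2 * r / √τ) ^ n := by
  have := h.isProbabilityMeasure
  refine le_trans ?_ (h.ball_le (2 * r) (by positivity))
  calc _ ≤ ∫ x, (closedBall m (2 * r)).indicator (fun _ => (1 : ℝ)) x ∂(gibbs H τ) := by
        refine integral_mono
          (h.integrable (contDiff_cutoff m r).continuous (hasCompactSupport_cutoff m hr))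
          ((integrable_const _).indicator measurableSet_closedBall) fun x => ?_
        by_cases hx : x ∈ closedBall m (2 * r)
        · simp only [Set.indicator_of_mem hx]
          exact cutoff_le_one m r x
        · simp only [Set.indicator_of_notMem hx]
          rw [mem_closedBall, dist_eq_norm, not_le] at hx
          exact (cutoff_eq_zero hr (by linarith)).le
    _ = _ := by
        rw [integral_indicator_const _ measurableSet_closedBall]; simp

end Cutoff

end InfSwap

namespace InfSwap

/-! ### Energy estimates and choice of scales -/

section LowerBound

open Metric Topology

variable {n : ℕ} {H : Space n → ℝ}

/-- The average of the cutoffs at the dyadic radii `r, 2r, …, 2 ^ (J - 1) r`. -/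
noncomputable def dyadicCutoff (m : Space n) (r : ℝ) (J : ℕ) (x : Space n) : ℝ :=
  (J : ℝ)⁻¹ * ∑ j ∈ Finset.range J, cutoff m (2 ^ j * r) x

theorem contDiff_dyadicCutoff (m : Space n) (r : ℝ) (J : ℕ) : ContDiff ℝ 1 (dyadicCutoff m r J) :=
  contDiff_const.mul (ContDiff.sum fun _ _ => contDiff_cutoff _ _)

theorem hasCompactSupport_dyadicCutoff (m : Space n) {r : ℝ} (hr : 0 < r) (J : ℕ) :
    HasCompactSupport (dyadicCutoff m r J) :=
  HasCompactSupport.intro (isCompact_closedBall m (3 / 2 * (2 ^ J * r))) fun x hx => by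
    rw [mem_closedBall, dist_eq_norm, not_le] at hx
    rw [dyadicCutoff, Finset.sum_eq_zero, mul_zero]
    intro j hj
    refine cutoff_eq_zero (by positivity) (lt_of_le_of_lt ?_ hx)
    gcongr
    · norm_num
    · exact (Finset.mem_range.1 hj).le

theorem gradient_dyadicCutoff (m : Space n) (r : ℝ) (J : ℕ) (x : Space n) :
    gradient (dyadicCutoff m r J) x =
      (J : ℝ)⁻¹ • ∑ j ∈ Finset.range J, gradient (cutoff m (2 ^ j * r)) x := by
  have hd : ∀ j ∈ Finset.range J, DifferentiableAt ℝ (cutoff m (2 ^ j * r)) x := fun j _ =>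
    (contDiff_cutoff m (2 ^ j * r)).differentiable (by norm_num) x
  have h : HasFDerivAt (dyadicCutoff m r J)
      ((J : ℝ)⁻¹ • ∑ j ∈ Finset.range J, fderiv ℝ (cutoff m (2 ^ j * r)) x) x :=
    (HasFDerivAt.fun_sum fun j hj => (hd j hj).hasFDerivAt).const_mul _
  simp only [gradient, h.fderiv, map_smul, map_sum]

theorem norm_gradient_dyadicCutoff_sq (m : Space n) {r : ℝ} (hr : 0 < r) (J : ℕ) (x : Space n) :
    ‖gradient (dyadicCutoff m r J) x‖ ^ 2 =
      ((J : ℝ)⁻¹) ^ 2 * ∑ j ∈ Finset.range J, ‖gradient (cutoff m (2 ^ j * r)) x‖ ^ 2 := by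
  rw [gradient_dyadicCutoff, norm_smul, mul_pow, norm_inv, Real.norm_natCast]
  congr 1
  -- At most one gradient is nonzero at `x`, so there are no cross terms: this is what turns `J⁻²`
  -- times `J` bounded energies into `O(1/J)`.
  by_cases h : ∃ j ∈ Finset.range J, gradient (cutoff m (2 ^ j * r)) x ≠ 0
  · obtain ⟨j, hj, hne⟩ := h
    have hother : ∀ i ∈ Finset.range J, i ≠ j → gradient (cutoff m (2 ^ i * r)) x = 0 := by
      intro i _ hij
      by_contra hi
      obtain ⟨h1, h2⟩ := shell_of_gradient_cutoff_ne_zero (by positivity) hne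
      obtain ⟨h3, h4⟩ := shell_of_gradient_cutoff_ne_zero (by positivity) hi
      have key : ∀ a b : ℕ, a < b → (2 : ℝ) ^ b * r ≤ 3 / 2 * (2 ^ a * r) → False := by
        intro a b hab hle
        have h5 : (2 : ℝ) ^ (a + 1) * r ≤ 2 ^ b * r := by
          gcongr
          · norm_num
          · exact hab
        have h6 : 0 < (2 : ℝ) ^ a * r := by positivity
        rw [pow_succ] at h5
        linarith
      rcases lt_or_gt_of_ne hij with hlt | hlt
      · exact key i j hlt (h1.trans h4)
      · exact key j i hlt (h3.trans h2)
    rw [Finset.sum_eq_single_of_mem j hj hother,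
      Finset.sum_eq_single_of_mem j hj fun i hi hij => by rw [hother i hi hij]; simp]
  · push Not at h
    rw [Finset.sum_eq_zero h, Finset.sum_eq_zero fun j hj => by rw [h j hj]; simp]
    simp

theorem energy_dyadicCutoff {m : Space n} {D α τ r : ℝ} (h : Concentrates H m D α τ)
    (hr : 0 < r) (J : ℕ) :
    energy H τ (dyadicCutoff m r J) =
      ((J : ℝ)⁻¹) ^ 2 * ∑ j ∈ Finset.range J, energy H τ (cutoff m (2 ^ j * r)) := by
  simp only [energy, norm_gradient_dyadicCutoff_sq m hr]
  rw [integral_const_mul, integral_finsetSum _ fun j _ => h.integrable_norm_gradient_sq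
    (contDiff_cutoff m _) (hasCompactSupport_cutoff m (by positivity)), ← Finset.mul_sum]
  ring

theorem integral_dyadicCutoff {m : Space n} {D α τ r : ℝ} (h : Concentrates H m D α τ)
    (hr : 0 < r) (J : ℕ) :
    ∫ x, dyadicCutoff m r J x ∂(gibbs H τ) =
      (J : ℝ)⁻¹ * ∑ j ∈ Finset.range J, ∫ x, cutoff m (2 ^ j * r) x ∂(gibbs H τ) := by
  simp only [dyadicCutoff]
  rw [integral_const_mul, integral_finsetSum _ fun j _ => h.integrable
    (contDiff_cutoff m _).continuous (hasCompactSupport_cutoff m (by positivity))]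

/-- The cutoff at a scale between `√τ₁` and `√τ₂` separates the two Gibbs measures. -/
theorem half_le_integral_cutoff_sub {m : Space n} {D α τ₁ τ₂ r K w : ℝ} (hn : n ≠ 0)
    (hα : 0 < α) (hD : 0 < D)
    (h₁ : Concentrates H m D α τ₁) (h₂ : Concentrates H m D α τ₂) (hτ₁ : 0 < τ₁) (hr : 0 < r)
    (hK : D * Real.exp (-α * K) ≤ 1 / 4) (hw : w ≤ 1 / 2) (hwD : w ≤ 1 / (8 * D))
    (hrK : K ≤ r / √τ₁) (hrw : r / √τ₂ ≤ w) :
    1 / 2 ≤ ∫ x, cutoff m r x ∂(gibbs H τ₁) - ∫ x, cutoff m r x ∂(gibbs H τ₂) := by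
  have h3 := le_integral_cutoff h₁ hτ₁ hr
  have h4 := integral_cutoff_le h₂ hr
  have h5 : D * Real.exp (-α * (r / √τ₁)) ≤ D * Real.exp (-α * K) := by
    simp only [neg_mul]
    gcongr
  have hnn : 0 ≤ 2 * r / √τ₂ := by positivity
  have h6 : (2 * r / √τ₂) ^ n ≤ 2 * r / √τ₂ :=
    pow_le_of_le_one hnn (by rw [mul_div_assoc]; linarith) hn
  have h7 : D * (2 * r / √τ₂) ^ n ≤ D * (2 * (1 / (8 * D))) := by
    gcongr
    rw [mul_div_assoc] at h6 ⊢
    linarith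
  have h8 : D * (2 * (1 / (8 * D))) = 1 / 4 := by field_simp; norm_num
  linarith

theorem exists_mul_exp_neg_le {D α : ℝ} (hD : 0 < D) (hα : 0 < α) :
    ∃ K : ℝ, 1 ≤ K ∧ D * Real.exp (-α * K) ≤ 1 / 4 := by
  -- Chosen so that `exp (αK) ≥ αK + 1 ≥ 4D`; the added 1 gives `K ≥ 1`.
  refine ⟨4 * D / α + 1, by linarith [show 0 < 4 * D / α by positivity], ?_⟩
  have h1 := Real.add_one_le_exp (α * (4 * D / α + 1))
  have h2 : α * (4 * D / α + 1) = 4 * D + α := by field_simp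
  rw [neg_mul, Real.exp_neg, ← div_eq_mul_inv, div_le_iff₀ (Real.exp_pos _)]
  linarith

/-- Energy of the cutoff at radius `r`, in terms of `r / √τ₁` and `r / √τ₂`. -/
theorem energy_cutoff_add_le {m : Space n} {D α τ₁ τ₂ M r : ℝ} {k : ℕ} (hn : n = k + 2)
    (hD : 0 < D) (h₁ : Concentrates H m D α τ₁) (h₂ : Concentrates H m D α τ₂) (hτ₁ : 0 < τ₁)
    (hτ₂ : 0 < τ₂) (hr : 0 < r) (hr1 : 1 ≤ r / √τ₁)
    (hM : ∀ x, ‖gradient (cutoff m r) x‖ ≤ M / r) :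
    energy H τ₁ (cutoff m r) + energy H τ₂ (cutoff m r) ≤
      M ^ 2 * D * (Real.exp (-α * (r / √τ₁)) + 2 ^ n * (r / √τ₂) ^ k) := by
  have hs₁ : 0 < √τ₁ := Real.sqrt_pos.2 hτ₁
  have hs₂ : 0 < √τ₂ := Real.sqrt_pos.2 hτ₂
  have e1 : energy H τ₁ (cutoff m r) ≤ M ^ 2 * D * Real.exp (-α * (r / √τ₁)) := by
    refine (energy_cutoff_le_tail h₁ hτ₁ hr hM).trans ?_
    have h : τ₁ / r ^ 2 ≤ 1 := by
      rw [div_le_one (by positivity)]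
      rw [le_div_iff₀ hs₁, one_mul] at hr1
      calc τ₁ = √τ₁ ^ 2 := (Real.sq_sqrt hτ₁.le).symm
        _ ≤ r ^ 2 := by gcongr
    calc _ = τ₁ / r ^ 2 * (M ^ 2 * D * Real.exp (-α * (r / √τ₁))) := by
          rw [div_pow]; ring
      _ ≤ 1 * (M ^ 2 * D * Real.exp (-α * (r / √τ₁))) := by gcongr
      _ = _ := one_mul _
  have e2 : energy H τ₂ (cutoff m r) ≤ M ^ 2 * D * (2 ^ n * (r / √τ₂) ^ k) := by
    refine (energy_cutoff_le_ball h₂ hτ₂ hr hM).trans_eq ?_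
    have h : τ₂ = √τ₂ ^ 2 := (Real.sq_sqrt hτ₂.le).symm
    -- Two of the `n` powers of `r / √τ₂` cancel the prefactor `τ₂ / r²`, leaving `k = n - 2`.
    have h' : τ₂ * (M / r) ^ 2 * (r / √τ₂) ^ 2 = M ^ 2 := by
      rw [div_pow, div_pow, ← h]
      field_simp
    rw [mul_div_assoc, mul_pow, hn, pow_add (r / √τ₂) k 2]
    linear_combination D * 2 ^ (k + 2) * (r / √τ₂) ^ k * h'
  linarith

theorem sqrt_eq_mul_sqrt_div {τ₁ τ₂ : ℝ} (hτ₁ : 0 < τ₁) : √τ₂ = √(τ₂ / τ₁) * √τ₁ := by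
  rw [← Real.sqrt_mul' _ hτ₁.le, div_mul_cancel₀ _ hτ₁.ne']

/-- Polynomial lower bound in dimension at least three. -/
theorem rpow_le_invSpectralGap {m : Space n} {D α M K w η : ℝ} (hn : 3 ≤ n) (hD : 0 < D)
    (hα : 0 < α) (hM0 : 0 < M)
    (hM : ∀ (m : Space n) (r : ℝ) (x : Space n), 0 < r → ‖gradient (cutoff m r) x‖ ≤ M / r)
    (hK1 : 1 ≤ K) (hK : D * Real.exp (-α * K) ≤ 1 / 4) (hw0 : 0 < w) (hw : w ≤ 1 / 2)
    (hwD : w ≤ 1 / (8 * D)) (hη : 0 < η) (hη2 : η ≤ 1 / 2) :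
    ∃ C : ℝ, 0 < C ∧ ∀ τ₁ τ₂ : ℝ, 0 < τ₁ → 0 < τ₂ → Concentrates H m D α τ₁ →
      Concentrates H m D α τ₂ → (4 * K / w) ^ 4 ≤ τ₂ / τ₁ →
      ENNReal.ofReal (C * (τ₂ / τ₁) ^ ((1 - η) * ((n : ℝ) - 2) / 2)) ≤
        invSpectralGap H τ₁ τ₂ := by
  obtain ⟨k, rfl⟩ : ∃ k, n = k + 2 := ⟨n - 2, by omega⟩
  -- Order of the Taylor term of `exp` used below: it is large enough that `(s ^ (η / 2)) ^ N`
  -- dominates the target power of `s`.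
  obtain ⟨N, hN⟩ := exists_nat_ge ((k : ℝ) / η)
  have hNk : (1 - η) * k / 2 ≤ η / 2 * N := by
    rw [div_le_iff₀ hη] at hN
    nlinarith [show (0 : ℝ) ≤ k from k.cast_nonneg]
  have hK0 : 0 < K := by linarith
  set A : ℝ := M ^ 2 * D * (N.factorial / (α * K) ^ N + 2 ^ (k + 2) * K ^ k) / 2 with hA
  have hA0 : 0 < A := by positivity
  refine ⟨1 / (16 * A), by positivity, fun τ₁ τ₂ hτ₁ hτ₂ h₁ h₂ hs => ?_⟩
  set s : ℝ := τ₂ / τ₁ with hsdef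
  have hs0 : 0 < s := by positivity
  have hKw : 1 ≤ 4 * K / w := by
    rw [le_div_iff₀ hw0]
    linarith
  have hs1 : 1 ≤ s := (one_le_pow₀ hKw).trans hs
  have hq1 : 0 < √τ₁ := Real.sqrt_pos.2 hτ₁
  have hqs : √τ₂ = s ^ (1 / 2 : ℝ) * √τ₁ := by
    rw [sqrt_eq_mul_sqrt_div hτ₁, Real.sqrt_eq_rpow (τ₂ / τ₁)]
  set r : ℝ := K * s ^ (η / 2) * √τ₁ with hr
  have hr0 : 0 < r := by positivity
  have hr1 : r / √τ₁ = K * s ^ (η / 2) := by rw [hr]; field_simp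
  have hr2 : r / √τ₂ = K * s ^ (η / 2 - 1 / 2) := by
    rw [hqs, hr, Real.rpow_sub hs0]
    field_simp
  have hsη : 1 ≤ s ^ (η / 2) := Real.one_le_rpow hs1 (by positivity)
  have hrK : K ≤ r / √τ₁ := by rw [hr1]; nlinarith
  have hrw : r / √τ₂ ≤ w := by
    -- Since `η ≤ 1/2`, the exponent `η / 2 - 1 / 2` is at most `-1/4`; hence the fourth power in
    -- the threshold on `s`, which is independent of `η`.
    have h5 : 4 * K / w ≤ s ^ (1 / 4 : ℝ) := by
      calc 4 * K / w = ((4 * K / w) ^ 4) ^ (1 / 4 : ℝ) := by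
            rw [← Real.rpow_natCast, ← Real.rpow_mul (by positivity)]
            norm_num
        _ ≤ s ^ (1 / 4 : ℝ) := by gcongr
    have h6 : s ^ (η / 2 - 1 / 2) ≤ (s ^ (1 / 4 : ℝ))⁻¹ := by
      rw [← Real.rpow_neg hs0.le]
      exact Real.rpow_le_rpow_of_exponent_le hs1 (by linarith)
    rw [hr2]
    calc K * s ^ (η / 2 - 1 / 2) ≤ K * (4 * K / w)⁻¹ := by
          gcongr
          exact h6.trans (by gcongr)
      _ = w / 4 := by field_simp
      _ ≤ w := by linarith
  set E : ℝ := (1 - η) * k / 2 with hE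
  have hexp : Real.exp (-α * (r / √τ₁)) ≤ N.factorial / (α * K) ^ N * s ^ (-E) := by
    have h5 := Real.pow_div_factorial_le_exp (α * (r / √τ₁)) (by positivity) N
    have h6 : s ^ E ≤ (s ^ (η / 2)) ^ N := by
      rw [← Real.rpow_natCast, ← Real.rpow_mul hs0.le]
      exact Real.rpow_le_rpow_of_exponent_le hs1 hNk
    rw [neg_mul, Real.exp_neg, Real.rpow_neg hs0.le]
    have h7 : (α * K) ^ N * s ^ E / N.factorial ≤ Real.exp (α * (r / √τ₁)) := by
      refine le_trans ?_ h5
      rw [hr1, ← mul_assoc, mul_pow (α * K)]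
      gcongr
    calc (Real.exp (α * (r / √τ₁)))⁻¹ ≤ ((α * K) ^ N * s ^ E / N.factorial)⁻¹ := by gcongr
      _ = _ := by field_simp
  have hpow : (r / √τ₂) ^ k = K ^ k * s ^ (-E) := by
    rw [hr2, mul_pow, ← Real.rpow_natCast (s ^ (η / 2 - 1 / 2)), ← Real.rpow_mul hs0.le]
    congr 2
    rw [hE]
    ring
  have henergy := energy_cutoff_add_le rfl hD h₁ h₂ hτ₁ hτ₂ hr0 (hK1.trans hrK)
    (fun x => hM m r x hr0)
  have hB : (energy H τ₁ (cutoff m r) + energy H τ₂ (cutoff m r)) / 2 ≤ A * s ^ (-E) := by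
    rw [hpow] at henergy
    calc _ ≤ M ^ 2 * D * (N.factorial / (α * K) ^ N * s ^ (-E) +
          2 ^ (k + 2) * (K ^ k * s ^ (-E))) / 2 := by
          gcongr
          refine henergy.trans ?_
          gcongr
      _ = _ := by rw [hA]; ring
  have := h₁.isProbabilityMeasure
  have := h₂.isProbabilityMeasure
  refine le_trans (ENNReal.ofReal_le_ofReal ?_) (le_invSpectralGap hτ₁ hτ₂
    h₁.absolutelyContinuous (contDiff_cutoff m r) (hasCompactSupport_cutoff m hr0) one_half_pos
    (half_le_integral_cutoff_sub (by omega) hα hD h₁ h₂ hτ₁ hr0 hK hw hwD hrK hrw) hB)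
  have hEE : (1 - η) * (((k + 2 : ℕ) : ℝ) - 2) / 2 = E := by rw [hE]; push_cast; ring
  rw [hEE, Real.rpow_neg hs0.le]
  refine le_of_eq ?_
  field_simp
  norm_num

/-- Logarithmic lower bound in dimension two. -/
theorem log_le_invSpectralGap {H : Space 2 → ℝ} {m : Space 2} {D α M K w : ℝ} (hD : 0 < D)
    (hα : 0 < α) (hM0 : 0 < M)
    (hM : ∀ (m : Space 2) (r : ℝ) (x : Space 2), 0 < r → ‖gradient (cutoff m r) x‖ ≤ M / r)
    (hK1 : 1 ≤ K) (hK : D * Real.exp (-α * K) ≤ 1 / 4) (hw0 : 0 < w) (hw : w ≤ 1 / 2)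
    (hwD : w ≤ 1 / (8 * D)) :
    ∃ c : ℝ, 0 < c ∧ ∀ τ₁ τ₂ : ℝ, 0 < τ₁ → 0 < τ₂ → Concentrates H m D α τ₁ →
      Concentrates H m D α τ₂ → (4 * K / w) ^ 4 ≤ τ₂ / τ₁ →
      ENNReal.ofReal (c * Real.log (τ₂ / τ₁)) ≤ invSpectralGap H τ₁ τ₂ := by
  have hK0 : 0 < K := by linarith
  set A : ℝ := M ^ 2 * D * 5 / 2 with hA
  have hA0 : 0 < A := by positivity
  refine ⟨1 / (128 * A), by positivity, fun τ₁ τ₂ hτ₁ hτ₂ h₁ h₂ hs => ?_⟩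
  set s : ℝ := τ₂ / τ₁ with hsdef
  have hs0 : 0 < s := by positivity
  set q : ℝ := 4 * K / w with hq
  have hKw : 1 ≤ q := by
    rw [hq, le_div_iff₀ hw0]
    linarith
  have hq1 : 0 < √τ₁ := Real.sqrt_pos.2 hτ₁
  have hss : 0 < √s := Real.sqrt_pos.2 hs0
  have hqs : √τ₂ = √s * √τ₁ := sqrt_eq_mul_sqrt_div hτ₁
  have hsq : q ^ 2 ≤ √s := Real.le_sqrt_of_sq_le (by rw [← pow_mul]; exact hs)
  -- This equals `w√s / K`, the largest factor by which `K√τ₁` can grow before exceeding `w√τ₂`; `J`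
  -- is the integer part of its binary logarithm.
  set y : ℝ := 4 * √s / q with hy
  have hy4 : 4 ≤ y := by
    rw [hy, le_div_iff₀ (by positivity)]
    nlinarith
  have hyw : y = w * √s / K := by rw [hy, hq]; field_simp
  obtain ⟨J, hJ1, hJ2⟩ := exists_nat_pow_near (x := y) (y := 2) (by linarith) one_lt_two
  have hJ0 : J ≠ 0 := by
    rintro rfl
    norm_num at hJ2
    linarith
  have hJ0' : (0 : ℝ) < J := by positivity
  -- From `q² ≤ √s` one gets `log y ≥ (log s) / 4`. Then `log y ≤ (J + 1) log 2 ≤ 2J` costs another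
  -- factor 2, using `J ≥ 1`.
  have hJlog : Real.log s / 8 ≤ J := by
    have h5 : Real.log y ≤ (J + 1 : ℕ) * Real.log 2 := by
      rw [← Real.log_pow]
      exact Real.log_le_log (by linarith) hJ2.le
    have h6 : Real.log s / 4 ≤ Real.log y := by
      have h7 : Real.log (√s) = Real.log s / 2 := Real.log_sqrt hs0.le
      have h8 : Real.log q * 2 ≤ Real.log (√s) := by
        have := Real.log_le_log (by positivity) hsq
        rw [Real.log_pow] at this
        push_cast at this
        linarith
      have h9 : Real.log y = Real.log 4 + Real.log (√s) - Real.log q := by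
        rw [hy, Real.log_div (by positivity) (by positivity),
          Real.log_mul (by norm_num) hss.ne']
      have h10 : 0 ≤ Real.log 4 := Real.log_nonneg (by norm_num)
      linarith
    have h11 : Real.log 2 ≤ 1 := by
      have := Real.log_two_lt_d9
      linarith
    have h12 : (1 : ℝ) ≤ J := by exact_mod_cast Nat.one_le_iff_ne_zero.2 hJ0
    push_cast at h5
    nlinarith [Real.log_nonneg (one_le_two (α := ℝ))]
  set r : ℝ := K * √τ₁ with hr
  have hr0 : 0 < r := by positivity
  have hrK : ∀ j : ℕ, K ≤ 2 ^ j * r / √τ₁ := fun j => by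
    rw [hr, le_div_iff₀ hq1]
    exact le_mul_of_one_le_left (by positivity) (one_le_pow₀ one_le_two)
  have hrw : ∀ j ∈ Finset.range J, 2 ^ j * r / √τ₂ ≤ w := fun j hj => by
    have h5 : (2 : ℝ) ^ j ≤ y :=
      (pow_le_pow_right₀ one_le_two (Finset.mem_range.1 hj).le).trans hJ1
    rw [hqs, hr, div_le_iff₀ (by positivity)]
    calc 2 ^ j * (K * √τ₁) ≤ y * (K * √τ₁) := by gcongr
      _ = _ := by rw [hyw]; field_simp
  have hdiff : 1 / 2 ≤ ∫ x, dyadicCutoff m r J x ∂(gibbs H τ₁) -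
      ∫ x, dyadicCutoff m r J x ∂(gibbs H τ₂) := by
    rw [integral_dyadicCutoff h₁ hr0, integral_dyadicCutoff h₂ hr0, ← mul_sub,
      ← Finset.sum_sub_distrib, inv_mul_eq_div, le_div_iff₀ hJ0']
    have := Finset.card_nsmul_le_sum (Finset.range J) _ (1 / 2 : ℝ) fun j hj =>
      half_le_integral_cutoff_sub two_ne_zero hα hD h₁ h₂ hτ₁
        (show 0 < 2 ^ j * r by positivity) hK hw hwD (hrK j) (hrw j hj)
    rw [Finset.card_range, nsmul_eq_mul] at this
    linarith
  have hB : (energy H τ₁ (dyadicCutoff m r J) + energy H τ₂ (dyadicCutoff m r J)) / 2 ≤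
      A / J := by
    rw [energy_dyadicCutoff h₁ hr0, energy_dyadicCutoff h₂ hr0, ← mul_add,
      ← Finset.sum_add_distrib]
    have hsum := Finset.sum_le_card_nsmul (Finset.range J)
      (fun j => energy H τ₁ (cutoff m (2 ^ j * r)) + energy H τ₂ (cutoff m (2 ^ j * r)))
      (2 * A) fun j _ => by
        refine (energy_cutoff_add_le (k := 0) rfl hD h₁ h₂ hτ₁ hτ₂
          (show 0 < 2 ^ j * r by positivity) (hK1.trans (hrK j))
          (fun x => hM m _ x (by positivity))).trans ?_
        have h5 : Real.exp (-α * (2 ^ j * r / √τ₁)) ≤ 1 := by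
          rw [Real.exp_le_one_iff, neg_mul, neg_nonpos]
          positivity
        calc _ ≤ M ^ 2 * D * (1 + 2 ^ 2 * (2 ^ j * r / √τ₂) ^ 0) := by gcongr
          _ = 2 * A := by rw [hA]; ring
    rw [Finset.card_range, nsmul_eq_mul] at hsum
    calc _ ≤ ((J : ℝ)⁻¹ ^ 2 * (J * (2 * A))) / 2 := by gcongr
      _ = A / J := by field_simp
  have := h₁.isProbabilityMeasure
  have := h₂.isProbabilityMeasure
  refine le_trans (ENNReal.ofReal_le_ofReal ?_) (le_invSpectralGap hτ₁ hτ₂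
    h₁.absolutelyContinuous (contDiff_dyadicCutoff m r J) (hasCompactSupport_dyadicCutoff m hr0 J)
    one_half_pos hdiff hB)
  calc 1 / (128 * A) * Real.log s = 1 / (16 * A) * (Real.log s / 8) := by ring
    _ ≤ 1 / (16 * A) * J := by gcongr
    _ = _ := by field_simp; norm_num

end LowerBound

end InfSwap

theorem proposition2p4 (n : ℕ) (H : InfSwap.Space n → ℝ)
    (hH : InfSwap.GrowthAssumption H) (hmin : InfSwap.HasUniqueGlobalMin H) :
    (3 ≤ n → ∃ τ₀ : ℝ, 0 < τ₀ ∧ ∃ κ₀ : ℝ, 0 < κ₀ ∧ ∀ η : ℝ, 0 < η → ∃ C : ℝ, 0 < C ∧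
      ∀ τ₁ τ₂ : ℝ, 0 < τ₁ → 0 < τ₂ → τ₂ ≤ τ₀ → τ₁ / τ₂ ≤ κ₀ →
        ENNReal.ofReal (C * (τ₂ / τ₁) ^ ((1 - η) * ((n : ℝ) - 2) / 2)) ≤
          InfSwap.invSpectralGap H τ₁ τ₂) ∧
    (n = 2 → ∃ τ₀ : ℝ, 0 < τ₀ ∧ ∃ κ₀ : ℝ, 0 < κ₀ ∧ ∃ c : ℝ, 0 < c ∧
      ∀ τ₁ τ₂ : ℝ, 0 < τ₁ → 0 < τ₂ → τ₂ ≤ τ₀ → τ₁ / τ₂ ≤ κ₀ →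
        ENNReal.ofReal (c * Real.log (τ₂ / τ₁)) ≤ InfSwap.invSpectralGap H τ₁ τ₂) := by
  obtain ⟨m, hm, hpos⟩ := hmin
  obtain ⟨D, α, τ₀, hD, hα, hτ₀, hconc⟩ := InfSwap.exists_concentrates hH hm hpos
  obtain ⟨M, hM0, hM⟩ := InfSwap.exists_norm_gradient_cutoff_le n
  obtain ⟨K, hK1, hK⟩ := InfSwap.exists_mul_exp_neg_le hD hα
  obtain ⟨w, hw0, hw, hwD⟩ : ∃ w : ℝ, 0 < w ∧ w ≤ 1 / 2 ∧ w ≤ 1 / (8 * D) :=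
    ⟨min (1 / 2) (1 / (8 * D)), by positivity, min_le_left _ _, min_le_right _ _⟩
  have hK0 : 0 < K := by linarith
  have hKw : 1 ≤ 4 * K / w := by
    rw [le_div_iff₀ hw0]
    linarith
  have hratio : ∀ τ₁ τ₂ : ℝ, 0 < τ₁ → 0 < τ₂ → τ₁ / τ₂ ≤ ((4 * K / w) ^ 4)⁻¹ →
      (4 * K / w) ^ 4 ≤ τ₂ / τ₁ := fun τ₁ τ₂ h₁ h₂ h => by
    rw [← inv_div τ₁ τ₂]
    exact (le_inv_comm₀ (by positivity) (by positivity)).1 h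
  have hlt : ∀ τ₁ τ₂ : ℝ, 0 < τ₁ → (4 * K / w) ^ 4 ≤ τ₂ / τ₁ → τ₁ ≤ τ₂ :=
    fun τ₁ τ₂ h₁ h => (one_le_div h₁).1 ((one_le_pow₀ hKw).trans h)
  refine ⟨fun hn => ⟨τ₀, hτ₀, ((4 * K / w) ^ 4)⁻¹, by positivity, fun η hη => ?_⟩, ?_⟩
  -- Replacing `η` by `min η (1 / 2)` only increases the power, because `τ₂ / τ₁ ≥ 1`; this lets
  -- `κ₀` be chosen before `η`.
  · obtain ⟨C, hC, h⟩ := InfSwap.rpow_le_invSpectralGap (H := H) (m := m) hn hD hα hM0 hM hK1 hK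
      hw0 hw hwD (lt_min hη one_half_pos) (min_le_right η (1 / 2))
    refine ⟨C, hC, fun τ₁ τ₂ hτ₁ hτ₂ hτ hκ => ?_⟩
    have hs := hratio τ₁ τ₂ hτ₁ hτ₂ hκ
    have hle := hlt τ₁ τ₂ hτ₁ hs
    refine le_trans (ENNReal.ofReal_le_ofReal ?_) (h τ₁ τ₂ hτ₁ hτ₂
      (hconc τ₁ hτ₁ (hle.trans hτ)) (hconc τ₂ hτ₂ hτ) hs)
    have hn2 : (0 : ℝ) ≤ (n : ℝ) - 2 := by
      have : (3 : ℝ) ≤ n := by exact_mod_cast hn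
      linarith
    gcongr
    · exact (one_le_div hτ₁).2 hle
    · exact min_le_left _ _
  · rintro rfl
    obtain ⟨c, hc, h⟩ := InfSwap.log_le_invSpectralGap (H := H) (m := m) hD hα hM0 hM hK1 hK
      hw0 hw hwD
    refine ⟨τ₀, hτ₀, ((4 * K / w) ^ 4)⁻¹, by positivity, c, hc, fun τ₁ τ₂ hτ₁ hτ₂ hτ hκ => ?_⟩
    have hs := hratio τ₁ τ₂ hτ₁ hτ₂ hκ
    exact h τ₁ τ₂ hτ₁ hτ₂ (hconc τ₁ hτ₁ ((hlt τ₁ τ₂ hτ₁ hs).trans hτ)) (hconc τ₂ hτ₂ hτ) hs
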